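/- **Theorem.** Let $n\ge 0$ and $r\ge 1$ be integers and let $s=(r,r,\ldots,r)$ ($n$ entries). Then $$d_n^s(z)=\sum_{\omega\in\mathcal{SW}(n+1,r)}z^{\mathrm{des}(\omega)},$$ and, moreover, the local $h$-polynomial of the $r$-th edgewise subdivision of the $n$-simplex $2^{[n+1]}$ equals the local $h^*$-polynomial $\ell^*(P_n^s;z)$ of the $s$-lecture hall simplex. Here the following notation is used. * For positive integers $s=(s_1,\ldots,s_n)$, the $s$-lecture hall simplex is $P_n^s=\{x\in\mathbb{R}^n: 0\le \frac{x_1}{s_1}\le\cdots\le\frac{x_n}{s_n}\le 1\}$. For a lattice simplex $P\subset\mathbb{R}^n$ with vertices $v_0,\ldots,v_d$, its local $h^*$-polynomial (box polynomial) is $\ell^*(P;z)=\sum_{x\in\Pi_P^\circ\cap\mathbb{Z}^{n+1}}z^{x_{n+1}}$, where $\Pi_P^\circ=\{\sum_i\lambda_i(v_i,1): 0<\lambda_i<1\}$. The $s$-derangement polynomial is $d_n^s(z)=\ell^*(P_n^s;z)$. * $\mathcal{SW}(m,r)$ is the set of Smirnov words $\omega=\omega_0\omega_1\cdots\omega_m$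 with $\omega_i\in\{0,\ldots,r-1\}$, $\omega_0=\omega_m=0$ and $\omega_i\ne\omega_{i+1}$ for $0\le i\le m-1$; $\mathrm{des}(\omega)$ is the number of $0\le i\le m-1$ with $\omega_i>\omega_{i+1}$. * The $r$-th edgewise subdivision of $2^{[m]}$ is the simplicial complex whose vertices are the lattice points of $r\Delta$, where $\Delta=\mathrm{conv}(e^{(1)},\ldots,e^{(m)})\subset\mathbb{R}^m$, and in which $F$ is a face if and only if for all $x,y\in F$ one has $\varphi(x)-\varphi(y)\in\{0,1\}^m$ or $\varphi(y)-\varphi(x)\in\{0,1\}^m$, where $\varphi(x)=(x_1,x_1+x_2,\ldots,x_1+\cdots+x_m)$. A face $F$ is mapped to the face $\bigcup_{x\in F}\{i: x_i\ne0\}$ of $2^{[m]}$. * For a complex $\Omega$ of dimension $k-1$ with $f_{i-1}$ faces having $i$ vertices ($f_{-1}=1$), $h(\Omega;z)=\sum_{i=0}^{k}f_{i-1}z^i(1-z)^{k-i}$. For a subdivision $\Omega$ of $2^V$, with $\Omega_F$ the subcomplex of the faces mapped into $F\subseteq V$, the local $h$-polynomial is $\ell_V(\Omega;z)=\sum_{F\subseteq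 V}(-1)^{|V|-|F|}h(\Omega_F;z)$. -/

import Mathlib

open scoped Polynomial Pointwise

noncomputable section

/-! ### `f`-, `h`- and local `h`-polynomials of finite simplicial complexes

Mathlib's (pre-)abstract simplicial complexes record only the nonempty faces. The empty face is
understood to be a face of every complex, so the complex `⊥` is the complex `{∅}`. -/

namespace PreAbstractSimplicialComplex

variable {α V : Type*}

/-- The number of faces with exactly `i` vertices, i.e. `f_{i-1}`; the empty face is counted. -/
def faceCount (K : PreAbstractSimplicialComplex α) (i : ℕ) : ℕ :=
  if i = 0 then 1 else {F ∈ K.faces | F.card = i}.ncard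

/-- The dimension of the complex plus one: the largest number of vertices of a face. -/
def rank (K : PreAbstractSimplicialComplex α) : ℕ :=
  sSup (Finset.card '' K.faces)

/-- The `f`-polynomial `∑ f_{i-1} z^i`. -/
def fPoly [Finite α] (K : PreAbstractSimplicialComplex α) : ℤ[X] :=
  ∑ i ∈ Finset.range (K.rank + 1), (K.faceCount i : ℤ[X]) * Polynomial.X ^ i

/-- The `h`-polynomial `(1-z)^n f(z/(1-z)) = ∑ f_{i-1} z^i (1-z)^{n-i}`, for a complex of
dimension `n-1`. -/
def hPoly [Finite α] (K : PreAbstractSimplicialComplex α) : ℤ[X] :=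
  ∑ i ∈ Finset.range (K.rank + 1),
    (K.faceCount i : ℤ[X]) * (Polynomial.X ^ i * (1 - Polynomial.X) ^ (K.rank - i))

/-- The defining relation between the `h`-polynomial and the `f`-polynomial. -/
theorem aeval_hPoly [Finite α] (K : PreAbstractSimplicialComplex α) (z : ℝ) (hz : z ≠ 1) :
    Polynomial.aeval z K.hPoly =
      (1 - z) ^ K.rank * Polynomial.aeval (z / (1 - z)) K.fPoly := by
  have h1 : (1 - z) ≠ 0 := sub_ne_zero.mpr hz.symm
  simp only [hPoly, fPoly, map_sum, map_mul, map_pow, map_natCast, Polynomial.aeval_X, map_sub,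
    map_one, Finset.mul_sum]
  refine Finset.sum_congr rfl fun i hi => ?_
  have hi' : i ≤ K.rank := Nat.lt_succ_iff.mp (Finset.mem_range.mp hi)
  rw [div_pow]
  nth_rewrite 2 [← Nat.sub_add_cancel hi']
  rw [pow_add]
  field_simp

/-- For a subdivision `K` of the simplex `2^V` with associated map `φ : K → 2^V`, the restriction
`K_W = φ⁻¹(2^W)` of `K` to the face `W`. -/
def restrictTo (K : PreAbstractSimplicialComplex α) (φ : Finset α →o Finset V) (W : Finset V) :
    PreAbstractSimplicialComplex α where
  faces := {F ∈ K.faces | φ F ⊆ W}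
  isRelLowerSet_faces := by
    rintro F ⟨hF, hFW⟩
    exact ⟨(K.isRelLowerSet_faces hF).1, fun G hG hne =>
      ⟨(K.isRelLowerSet_faces hF).2 hG hne, (φ.monotone hG).trans hFW⟩⟩

/-- The local `h`-polynomial `ℓ_W(K_W; z) = ∑_{F ⊆ W} (-1)^{|W|-|F|} h(K_F; z)`. -/
def localHPoly [Finite α] (K : PreAbstractSimplicialComplex α) (φ : Finset α →o Finset V)
    (W : Finset V) : ℤ[X] :=
  ∑ F ∈ W.powerset, (-1) ^ (W.card - F.card) * (K.restrictTo φ F).hPoly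

/-- The local `h`-polynomials satisfy the relation `h(K_W; z) = ∑_{F ⊆ W} ℓ_F(K_F; z)`. -/
theorem hPoly_eq_sum_localHPoly [Finite α] (K : PreAbstractSimplicialComplex α)
    (φ : Finset α →o Finset V) (W : Finset V) :
    (K.restrictTo φ W).hPoly = ∑ F ∈ W.powerset, K.localHPoly φ F := by
  classical
  simp only [localHPoly]
  rw [Finset.sum_comm' (t' := W.powerset) (s' := fun G => Finset.Icc G W)
    (by
      intro F G
      simp only [Finset.mem_powerset, Finset.mem_Icc]
      exact ⟨fun h => ⟨⟨h.2, h.1⟩, h.2.trans h.1⟩, fun h => ⟨h.1.2, h.1.1⟩⟩)]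
  have key : ∀ G ∈ W.powerset,
      ∑ F ∈ Finset.Icc G W, (-1 : ℤ[X]) ^ (F.card - G.card) * (K.restrictTo φ G).hPoly =
        if G = W then (K.restrictTo φ G).hPoly else 0 := by
    intro G hG
    have hGW := Finset.mem_powerset.mp hG
    rw [← Finset.sum_mul, Finset.Icc_eq_image_powerset hGW, Finset.sum_image]
    · have h2 : ∀ H ∈ (W \ G).powerset,
          (-1 : ℤ[X]) ^ ((G ∪ H).card - G.card) = (((-1 : ℤ) ^ H.card : ℤ) : ℤ[X]) := by
        intro H hH
        have hd : Disjoint G H :=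
          (Finset.disjoint_sdiff (s := G) (t := W)).mono_right (Finset.mem_powerset.mp hH)
        rw [Finset.card_union_of_disjoint hd, Nat.add_sub_cancel_left]
        push_cast
        rfl
      rw [Finset.sum_congr rfl h2, ← Int.cast_sum, Finset.sum_powerset_neg_one_pow_card]
      have h3 : W \ G = ∅ ↔ G = W :=
        ⟨fun h => hGW.antisymm (Finset.sdiff_eq_empty_iff_subset.mp h), fun h => by simp [h]⟩
      by_cases h : G = W
      · simp [h]
      · simp [h3, h]
    · intro A hA B hB hAB
      have hA' := Finset.mem_powerset.mp hA
      have hB' := Finset.mem_powerset.mp hB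
      have dA : Disjoint G A := (Finset.disjoint_sdiff (s := G) (t := W)).mono_right hA'
      have dB : Disjoint G B := (Finset.disjoint_sdiff (s := G) (t := W)).mono_right hB'
      have h := congrArg (· \ G) hAB
      simpa [Finset.union_sdiff_cancel_left dA, Finset.union_sdiff_cancel_left dB] using h
  rw [Finset.sum_congr rfl key, Finset.sum_ite_eq' W.powerset W]
  simp

end PreAbstractSimplicialComplex

/-! ### The edgewise subdivision -/

/-- The lattice points of `r Δ`, where `Δ ⊆ ℝⁿ` is the convex hull of the standard basis. -/
abbrev EdgewiseVertex (n r : ℕ) : Type :=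
  {x : Fin n → ℤ // (fun i => (x i : ℝ)) ∈ (r : ℝ) • stdSimplex ℝ (Fin n)}

instance (n r : ℕ) : Finite (EdgewiseVertex n r) := by
  refine Set.Finite.subset (Set.finite_Icc (0 : Fin n → ℤ) (fun _ => (r : ℤ))) ?_
  rintro x ⟨y, hy, hxy⟩
  have hx : ∀ i, (r : ℝ) * y i = (x i : ℝ) := fun i => congrFun hxy i
  have hr : (0 : ℝ) ≤ r := Nat.cast_nonneg r
  refine ⟨fun i => ?_, fun i => ?_⟩
  · have : (0 : ℝ) ≤ (x i : ℝ) := by rw [← hx i]; exact mul_nonneg hr (hy.1 i)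
    exact_mod_cast this
  · have h1 : y i ≤ 1 := by
      rw [← hy.2]; exact Finset.single_le_sum (fun j _ => hy.1 j) (Finset.mem_univ i)
    have : (x i : ℝ) ≤ (r : ℝ) := by rw [← hx i]; exact mul_le_of_le_one_right hr h1
    exact_mod_cast this

/-- The support `{i : x_i ≠ 0}` of an integer vector. -/
def latticeSupp {n : ℕ} (x : Fin n → ℤ) : Finset (Fin n) :=
  {i | x i ≠ 0}

/-- The vector `(x₁, x₁ + x₂, …, x₁ + ⋯ + xₙ)` of partial sums. -/
def partialSums {n : ℕ} (x : Fin n → ℤ) : Fin n → ℤ :=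
  fun i => ∑ j ∈ Finset.Iic i, x j

/-- The `r`-th edgewise subdivision of the simplex `2^[n]` (of dimension `n - 1`). -/
def edgewiseSubdivision (n r : ℕ) : PreAbstractSimplicialComplex (EdgewiseVertex n r) where
  faces := {F | F.Nonempty ∧ ∀ x ∈ F, ∀ y ∈ F,
    (∀ i, partialSums x.1 i - partialSums y.1 i ∈ ({0, 1} : Set ℤ)) ∨
    (∀ i, partialSums y.1 i - partialSums x.1 i ∈ ({0, 1} : Set ℤ))}
  isRelLowerSet_faces := by
    rintro F ⟨hF, h⟩
    exact ⟨hF, fun G hG hne => ⟨hne, fun x hx y hy => h x (hG hx) y (hG hy)⟩⟩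

/-- The map from the edgewise subdivision to `2^[n]`: a face `F` is sent to the smallest face of
the simplex containing it, the union of the supports of its vertices. -/
def edgewiseCarrier (n r : ℕ) : Finset (EdgewiseVertex n r) →o Finset (Fin n) where
  toFun F := F.biUnion fun x => latticeSupp x.1
  monotone' _ _ h := Finset.biUnion_subset_biUnion_of_subset_left _ h

/-- The local `h`-polynomial of the `r`-th edgewise subdivision of `2^[n]`. -/
def edgewiseLocalHPoly (n r : ℕ) : ℤ[X] :=
  (edgewiseSubdivision n r).localHPoly (edgewiseCarrier n r) Finset.univ

/-! ### Local `h^*`-polynomials and `s`-lecture hall simplices -/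

/-- The open parallelepiped `{∑ λ_v (v, 1) : 0 < λ_v < 1} ⊆ ℝ^{n+1}`, the sum being over the
vertices `v` of the simplex `P ⊆ ℝⁿ`. -/
def openParallelepiped {n : ℕ} (P : Set (Fin n → ℝ)) : Set (Fin (n + 1) → ℝ) :=
  {x | ∃ c : (Fin n → ℝ) → ℝ, (∀ v ∈ P.extremePoints ℝ, 0 < c v ∧ c v < 1) ∧
    x = ∑ᶠ v ∈ P.extremePoints ℝ, c v • (Fin.snoc v 1 : Fin (n + 1) → ℝ)}

/-- The local `h^*`-polynomial (box polynomial) of a lattice simplex `P ⊆ ℝⁿ`: the sum of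
`z^{x_{n+1}}` over the (finitely many) integer points `x` of the open parallelepiped, all of which
have `x_{n+1} > 0`. -/
def localHStarPoly {n : ℕ} (P : Set (Fin n → ℝ)) : ℤ[X] :=
  ∑ᶠ x ∈ {x : Fin (n + 1) → ℤ | (fun i => (x i : ℝ)) ∈ openParallelepiped P},
    Polynomial.X ^ (x (Fin.last n)).toNat

/-- The `s`-lecture hall simplex `{x : 0 ≤ x₁/s₁ ≤ x₂/s₂ ≤ ⋯ ≤ xₙ/sₙ ≤ 1}`. -/
def lectureHallSimplex {n : ℕ} (s : Fin n → ℕ) : Set (Fin n → ℝ) :=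
  {x | (∀ i, 0 ≤ x i / s i) ∧ (∀ i j, i ≤ j → x i / s i ≤ x j / s j) ∧ ∀ i, x i / s i ≤ 1}

/-- The `s`-derangement polynomial. -/
def sDerangementPoly {n : ℕ} (s : Fin n → ℕ) : ℤ[X] :=
  localHStarPoly (lectureHallSimplex s)

/-! ### Smirnov words -/

/-- The Smirnov words `ω₀ω₁⋯ωₙ` over `{0, …, r-1}`: `ω₀ = ωₙ = 0` and consecutive letters are
distinct. -/
def smirnovWords (n r : ℕ) : Finset (Fin (n + 1) → Fin r) :=
  {ω | (ω 0 : ℕ) = 0 ∧ (ω (Fin.last n) : ℕ) = 0 ∧ ∀ i : Fin n, ω i.castSucc ≠ ω i.succ}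

/-- The number of descents of a word. -/
def wordDes {n r : ℕ} (ω : Fin (n + 1) → Fin r) : ℕ :=
  Finset.card {i : Fin n | ω i.castSucc > ω i.succ}

end

/-! All three polynomials equal the sum of `z ^ ((∑ i, a i) / r)` over `boxVectors (n + 1) r`.
Smirnov words: the partial sums of `a` modulo `r` spell a word, and each descent is a carry, that
is, a unit step of the integer quotient of the partial sum by `r`
(`sum_boxVectors_eq_sum_smirnovWords`). Box polynomial: a point `∑ λ_k (v_k, 1)` has as coordinates
the partial sums of `a = r λ`, followed by `(∑ a) / r`, so it is integral exactly when `a` is a box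
vector (`localHStarPoly_lectureHallSimplex`). Edgewise subdivision: every lattice point of `r t Δ`
is in a unique way a sum of `t` vertices spanning a face (`vertexSum_injOn`, `exists_vertexSum_eq`).
Hence `h(Ω_F)` keeps the exponents divisible by `r` in `((1 - X^r)/(1 - X))^|F|`. The alternating
sum over `F` is a binomial expansion, leaving the same exponents of `(X + ⋯ + X^(r-1))^m`, whose
coefficients count box vectors (`edgewiseLocalHPoly_eq_sum_boxVectors`). -/

noncomputable section

/-! ### Partial sums of finite sequences. -/

namespace Fin

theorem partialSum_last {M : Type*} [AddCommMonoid M] {n : ℕ} (f : Fin n → M) :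
    partialSum f (last n) = ∑ i, f i := by
  rw [partialSum, ← List.sum_ofFn, List.take_of_length_le (by simp)]

theorem eq_partialSum {M : Type*} [AddMonoid M] {n : ℕ} {f : Fin n → M} {g : Fin (n + 1) → M}
    (h0 : g 0 = 0) (hs : ∀ i : Fin n, g i.succ = g i.castSucc + f i) : g = partialSum f := by
  funext i
  induction i using Fin.induction with
  | zero => rw [h0, partialSum_zero]
  | succ i ih => rw [hs, partialSum_succ, ih]

theorem partialSum_injective {M : Type*} [AddLeftCancelMonoid M] {n : ℕ} :
    Function.Injective (partialSum : (Fin n → M) → Fin (n + 1) → M) := by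
  intro f g h
  funext i
  have h1 := congrFun h i.succ
  rwa [partialSum_succ, partialSum_succ, h, add_right_inj] at h1

theorem sum_Iic_eq_partialSum {M : Type*} [AddCommMonoid M] {n : ℕ} (f : Fin n → M) (i : Fin n) :
    ∑ j ∈ Finset.Iic i, f j = partialSum f i.succ := by
  obtain ⟨m, rfl⟩ : ∃ m, n = m + 1 := ⟨n - 1, by have := i.pos; omega⟩
  induction i using Fin.induction with
  | zero =>
    have : Finset.Iic (0 : Fin (m + 1)) = {0} := by ext j; simp
    rw [this, Finset.sum_singleton, partialSum_succ, castSucc_zero, partialSum_zero, zero_add]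
  | succ i ih =>
    have : Finset.Iic i.succ = insert i.succ (Finset.Iic i.castSucc) := by
      ext j
      simp only [Finset.mem_Iic, Finset.mem_insert, Fin.le_def, Fin.ext_iff, val_succ,
        val_castSucc]
      omega
    rw [this, Finset.sum_insert (by simp [Fin.le_def]), ih, partialSum_succ _ i.succ,
      castSucc_succ, add_comm]

end Fin

/-! ### Box vectors and Smirnov words. -/

/-- The vectors in `{1, …, r-1}^m` whose coordinate sum is divisible by `r`. -/
def boxVectors (m r : ℕ) : Finset (Fin m → ℕ) :=
  {a ∈ Fintype.piFinset fun _ => Finset.Ioo 0 r | r ∣ ∑ i, a i}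

theorem mem_boxVectors {m r : ℕ} {a : Fin m → ℕ} :
    a ∈ boxVectors m r ↔ (∀ i, 0 < a i ∧ a i < r) ∧ r ∣ ∑ i, a i := by
  simp [boxVectors]

theorem mem_smirnovWords {m r : ℕ} {ω : Fin (m + 1) → Fin r} :
    ω ∈ smirnovWords m r ↔
      (ω 0 : ℕ) = 0 ∧ (ω (Fin.last m) : ℕ) = 0 ∧ ∀ i : Fin m, ω i.castSucc ≠ ω i.succ := by
  simp [smirnovWords]

/-- A step strictly between `0` and `r` carries at most once, and it carries exactly when the
residue drops; the two residues then recover the step. -/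
theorem add_div_mod_of_lt {r S a : ℕ} (ha : 0 < a) (har : a < r) :
    (S + a) % r ≠ S % r ∧ (S + a) / r = S / r + (if (S + a) % r < S % r then 1 else 0) ∧
      a = if S % r < (S + a) % r then (S + a) % r - S % r else (S + a) % r + r - S % r := by
  have hr : 0 < r := by omega
  have h1 := Nat.div_add_mod S r
  have h2 := Nat.mod_lt S hr
  by_cases h : S % r + a < r
  · obtain ⟨hd, hm⟩ := (Nat.div_mod_unique (a := S + a) (c := S % r + a) (d := S / r) hr).2
      ⟨by omega, h⟩
    rw [hd, hm, if_neg (by omega), if_pos (by omega)]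
    omega
  · obtain ⟨hd, hm⟩ := (Nat.div_mod_unique (a := S + a) (c := S % r + a - r) (d := S / r + 1)
      hr).2 ⟨by rw [Nat.mul_add]; omega, by omega⟩
    rw [hd, hm, if_pos (by omega), if_neg (by omega)]
    omega

/-- Each step is congruent to the difference of consecutive letters, so the sum telescopes modulo
`r`. -/
theorem partialSum_smirnov_mod {m r : ℕ} {ω : Fin (m + 1) → Fin r} (h0 : (ω 0 : ℕ) = 0)
    (k : Fin (m + 1)) :
    Fin.partialSum (fun k : Fin m => if (ω k.castSucc : ℕ) < ω k.succ
      then (ω k.succ : ℕ) - ω k.castSucc else ω k.succ + r - ω k.castSucc) k % r = ω k := by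
  induction k using Fin.induction with
  | zero => simp [h0]
  | succ i ih =>
    have h1 := (ω i.castSucc).2
    have h2 := (ω i.succ).2
    rw [Fin.partialSum_succ, Nat.add_mod, ih]
    split_ifs with h
    · rw [Nat.add_mod_mod, Nat.add_sub_cancel' h.le, Nat.mod_eq_of_lt h2]
    · rw [Nat.add_mod_mod, Nat.add_sub_cancel' (by omega), Nat.add_mod_right,
        Nat.mod_eq_of_lt h2]

theorem sum_boxVectors_eq_sum_smirnovWords {r : ℕ} (m : ℕ) (hr : 0 < r) :
    ∑ a ∈ boxVectors m r, (Polynomial.X : ℤ[X]) ^ ((∑ i, a i) / r) =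
      ∑ ω ∈ smirnovWords m r, Polynomial.X ^ wordDes ω := by
  refine Finset.sum_nbij' (fun a k => ⟨Fin.partialSum a k % r, Nat.mod_lt _ hr⟩)
    (fun ω k => if (ω k.castSucc : ℕ) < ω k.succ then (ω k.succ : ℕ) - ω k.castSucc
      else ω k.succ + r - ω k.castSucc) ?_ ?_ ?_ ?_ ?_
  · intro a ha
    obtain ⟨h1, h2⟩ := mem_boxVectors.1 ha
    rw [mem_smirnovWords]
    refine ⟨by simp, ?_, fun i h => ?_⟩
    · simpa only [Fin.partialSum_last] using Nat.mod_eq_zero_of_dvd h2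
    · have := (add_div_mod_of_lt (S := Fin.partialSum a i.castSucc) (h1 i).1 (h1 i).2).1
      rw [← Fin.partialSum_succ] at this
      exact this (Fin.ext_iff.1 h).symm
  · intro ω hω
    obtain ⟨h0, hl, hne⟩ := mem_smirnovWords.1 hω
    rw [mem_boxVectors]
    refine ⟨fun i => ?_, ?_⟩
    · have := Fin.val_ne_of_ne (hne i)
      have := (ω i.castSucc).2
      have := (ω i.succ).2
      split_ifs <;> omega
    · rw [← Fin.partialSum_last, Nat.dvd_iff_mod_eq_zero, partialSum_smirnov_mod h0, hl]
  · intro a ha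
    obtain ⟨h1, h2⟩ := mem_boxVectors.1 ha
    funext i
    have := (add_div_mod_of_lt (S := Fin.partialSum a i.castSucc) (h1 i).1 (h1 i).2).2.2
    rw [← Fin.partialSum_succ] at this
    exact this.symm
  · intro ω hω
    obtain ⟨h0, hl, hne⟩ := mem_smirnovWords.1 hω
    exact funext fun k => Fin.ext (partialSum_smirnov_mod h0 k)
  · intro a ha
    obtain ⟨h1, h2⟩ := mem_boxVectors.1 ha
    congr 1
    rw [wordDes, Finset.card_filter, ← Fin.partialSum_last, ← Fin.partialSum_last]
    -- The quotients by `r` start at `0` and grow by one at each descent, so the last quotient is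
    -- the number of descents.
    refine congrFun (Fin.eq_partialSum (g := fun k => Fin.partialSum a k / r) (by simp)
      fun i => ?_) _
    have := (add_div_mod_of_lt (S := Fin.partialSum a i.castSucc) (h1 i).1 (h1 i).2).2.1
    rw [← Fin.partialSum_succ] at this
    simpa only [gt_iff_lt, Fin.mk_lt_mk] using this

/-! ### The lecture hall simplex and its box polynomial. -/

/-- The vertices `(0, …, 0, r, …, r)` of the lecture hall simplex of `s = (r, …, r)`. -/
def lectureHallVertex (n r : ℕ) (k : Fin (n + 1)) : Fin n → ℝ :=
  fun i => if k ≤ i.castSucc then (r : ℝ) else 0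

theorem mem_lectureHallSimplex_const {n r : ℕ} (hr : 0 < r) {x : Fin n → ℝ} :
    x ∈ lectureHallSimplex (fun _ : Fin n => r) ↔ Monotone x ∧ ∀ i, 0 ≤ x i ∧ x i ≤ r := by
  have hr' : (0 : ℝ) < r := by exact_mod_cast hr
  simp only [lectureHallSimplex, Set.mem_ofPred_eq, div_le_div_iff_of_pos_right hr',
    div_le_one hr', le_div_iff₀ hr', zero_mul, Monotone]
  exact ⟨fun h => ⟨fun i j => h.2.1 i j, fun i => ⟨h.1 i, h.2.2 i⟩⟩,
    fun h => ⟨fun i => (h.2 i).1, fun i j => @h.1 i j, fun i => (h.2 i).2⟩⟩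

theorem lectureHallVertex_mem {n r : ℕ} (hr : 0 < r) (k : Fin (n + 1)) :
    lectureHallVertex n r k ∈ lectureHallSimplex (fun _ : Fin n => r) := by
  rw [mem_lectureHallSimplex_const hr]
  refine ⟨fun i j hij => ?_, fun i => ?_⟩
  · simp only [lectureHallVertex]
    split_ifs with h1 h2
    · rfl
    · exact absurd (h1.trans (Fin.castSucc_le_castSucc_iff.2 hij)) h2
    · positivity
    · rfl
  · simp only [lectureHallVertex]
    split_ifs <;> simp

theorem lectureHallVertex_injective {n r : ℕ} (hr : 0 < r) :
    Function.Injective (lectureHallVertex n r) := by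
  have key : ∀ k l : Fin (n + 1), k < l → lectureHallVertex n r k ≠ lectureHallVertex n r l := by
    intro k l hkl h
    have h1 := congrFun h (k.castPred (Fin.ne_last_of_lt hkl))
    simp [lectureHallVertex, hkl, hr.ne'] at h1
  intro k l h
  by_contra hne
  rcases lt_or_gt_of_ne hne with h1 | h1
  · exact key _ _ h1 h
  · exact key _ _ h1 h.symm

theorem sum_mul_lectureHallVertex {n r : ℕ} (w : Fin (n + 1) → ℝ) (i : Fin n) :
    ∑ k, w k * lectureHallVertex n r k i = r * Fin.partialSum w i.castSucc.succ := by
  rw [← Fin.sum_Iic_eq_partialSum, Finset.mul_sum]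
  simp only [lectureHallVertex, mul_ite, mul_zero]
  rw [← Finset.sum_filter]
  exact Finset.sum_congr (by ext; simp) fun _ _ => mul_comm _ _

theorem lectureHallSimplex_subset_convexHull {n r : ℕ} (hr : 0 < r) :
    lectureHallSimplex (fun _ : Fin n => r) ⊆
      convexHull ℝ (Set.range (lectureHallVertex n r)) := by
  intro x hx
  obtain ⟨hm, hb⟩ := (mem_lectureHallSimplex_const hr).1 hx
  have hr' : (0 : ℝ) < r := by exact_mod_cast hr
  -- Padding `x` by `0` and `r` makes the barycentric coordinates the successive gaps divided by
  -- `r`; monotonicity of `Y` is their nonnegativity.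
  set Y : Fin (n + 2) → ℝ := Fin.cons 0 (Fin.snoc x r) with hY
  set w : Fin (n + 1) → ℝ := fun k => (Y k.succ - Y k.castSucc) / r with hw
  have hYw : ∀ k, Y k / r = Fin.partialSum w k := by
    refine congrFun (Fin.eq_partialSum (by simp [hY]) fun i => ?_)
    rw [hw]
    ring
  have hYm : Monotone Y := by
    refine Fin.monotone_iff_le_succ.2 fun i => ?_
    induction i using Fin.cases with
    | zero =>
      rw [Fin.castSucc_zero, hY, Fin.cons_zero, Fin.cons_succ]
      induction (0 : Fin (n + 1)) using Fin.lastCases with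
      | last => simp
      | cast i => simpa using (hb i).1
    | succ i =>
      rw [← Fin.succ_castSucc, hY, Fin.cons_succ, Fin.cons_succ, Fin.snoc_castSucc]
      obtain ⟨j, hj⟩ : ∃ j, j = i.succ := ⟨_, rfl⟩
      rw [← hj]
      induction j using Fin.lastCases with
      | last => simpa using (hb i).2
      | cast j =>
        simp only [Fin.snoc_castSucc]
        refine hm ?_
        rw [Fin.ext_iff] at hj
        simp only [Fin.val_castSucc, Fin.val_succ] at hj
        rw [Fin.le_def]
        omega
  have hx' : x = ∑ k, w k • lectureHallVertex n r k := by
    funext i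
    rw [Finset.sum_apply]
    simp only [Pi.smul_apply, smul_eq_mul]
    rw [sum_mul_lectureHallVertex, ← hYw, hY, Fin.cons_succ, Fin.snoc_castSucc]
    field_simp
  rw [hx']
  refine (convex_convexHull ℝ _).sum_mem (fun k _ => ?_) ?_
    fun k _ => subset_convexHull ℝ _ ⟨k, rfl⟩
  · exact div_nonneg (sub_nonneg.2 (hYm (Fin.castSucc_lt_succ).le)) hr'.le
  · rw [← Fin.partialSum_last, ← hYw, hY, ← Fin.succ_last, Fin.cons_succ, Fin.snoc_last,
      div_self hr'.ne']

theorem convex_lectureHallSimplex_const {n r : ℕ} (hr : 0 < r) :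
    Convex ℝ (lectureHallSimplex (fun _ : Fin n => r)) := by
  intro x hx y hy a b ha hb hab
  rw [mem_lectureHallSimplex_const hr] at hx hy ⊢
  refine ⟨(hx.1.const_mul ha).add (hy.1.const_mul hb), fun i => ?_⟩
  simp only [Pi.add_apply, Pi.smul_apply, smul_eq_mul]
  have h1 := hx.2 i
  have h2 := hy.2 i
  constructor
  · exact add_nonneg (mul_nonneg ha h1.1) (mul_nonneg hb h2.1)
  · calc a * x i + b * y i ≤ a * r + b * r :=
        add_le_add (mul_le_mul_of_nonneg_left h1.2 ha) (mul_le_mul_of_nonneg_left h2.2 hb)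
      _ = r := by rw [← add_mul, hab, one_mul]

/-- Every coordinate of a vertex is an endpoint of `[0, r]`, so a proper convex combination equal to
it must agree with it in each coordinate. -/
theorem extremePoints_lectureHallSimplex {n r : ℕ} (hr : 0 < r) :
    (lectureHallSimplex (fun _ : Fin n => r)).extremePoints ℝ =
      Set.range (lectureHallVertex n r) := by
  have hP : lectureHallSimplex (fun _ : Fin n => r) =
      convexHull ℝ (Set.range (lectureHallVertex n r)) :=
    (lectureHallSimplex_subset_convexHull hr).antisymm <| convexHull_min
      (by rintro _ ⟨k, rfl⟩; exact lectureHallVertex_mem hr k)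
      (convex_lectureHallSimplex_const hr)
  refine Set.Subset.antisymm ?_ ?_
  · rw [hP]
    exact extremePoints_convexHull_subset
  · rintro _ ⟨k, rfl⟩
    refine mem_extremePoints_iff_left.2 ⟨lectureHallVertex_mem hr k, ?_⟩
    rintro x hx y hy ⟨a, b, ha, hb, hab, h⟩
    rw [mem_lectureHallSimplex_const hr] at hx hy
    funext i
    have h1 := hx.2 i
    have h2 := hy.2 i
    have h3 := congrFun h i
    simp only [Pi.add_apply, Pi.smul_apply, smul_eq_mul, lectureHallVertex] at h3 ⊢
    split_ifs at h3 ⊢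
    · by_contra hne
      have h4 := mul_pos ha (sub_pos.2 (lt_of_le_of_ne h1.2 hne))
      have h5 := mul_nonneg hb.le (sub_nonneg.2 h2.2)
      have h6 : a * r + b * r = r := by rw [← add_mul, hab, one_mul]
      linarith
    · by_contra hne
      have h4 := mul_pos ha (lt_of_le_of_ne h1.1 (Ne.symm hne))
      have h5 := mul_nonneg hb.le h2.1
      linarith

theorem mem_openParallelepiped_lectureHallSimplex {n r : ℕ} (hr : 0 < r)
    {x : Fin (n + 1) → ℝ} :
    x ∈ openParallelepiped (lectureHallSimplex (fun _ : Fin n => r)) ↔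
      ∃ w : Fin (n + 1) → ℝ, (∀ k, 0 < w k ∧ w k < 1) ∧
        (∀ i : Fin n, x i.castSucc = r * Fin.partialSum w i.castSucc.succ) ∧
        x (Fin.last n) = Fin.partialSum w (Fin.last (n + 1)) := by
  have hinj := lectureHallVertex_injective (n := n) hr
  have key : ∀ c : (Fin n → ℝ) → ℝ,
      x = ∑ᶠ v ∈ Set.range (lectureHallVertex n r),
        c v • (Fin.snoc v 1 : Fin (n + 1) → ℝ) ↔
      (∀ i : Fin n, x i.castSucc =
        r * Fin.partialSum (fun k => c (lectureHallVertex n r k)) i.castSucc.succ) ∧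
        x (Fin.last n) =
          Fin.partialSum (fun k => c (lectureHallVertex n r k)) (Fin.last (n + 1)) := by
    intro c
    rw [finsum_mem_range hinj, finsum_eq_sum_of_fintype, funext_iff, Fin.forall_fin_succ',
      Fin.partialSum_last]
    simp [Finset.sum_apply, ← sum_mul_lectureHallVertex]
  simp only [openParallelepiped, Set.mem_ofPred_eq, extremePoints_lectureHallSimplex hr, key,
    Set.forall_mem_range]
  constructor
  · rintro ⟨c, h1, h2⟩
    exact ⟨_, h1, h2⟩
  · rintro ⟨w, h1, h2⟩
    -- Coefficients are functions on all of space, but only their values at vertices matter; `0` is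
    -- a filler elsewhere.
    refine ⟨Function.extend (lectureHallVertex n r) w 0, ?_⟩
    simp only [hinj.extend_apply]
    exact ⟨h1, h2⟩

theorem exists_int_of_partialSum {m : ℕ} {d : Fin m → ℝ} {Y : Fin (m + 1) → ℤ}
    (h : ∀ k, (Y k : ℝ) = Fin.partialSum d k) (i : Fin m) :
    d i = ((Y i.succ - Y i.castSucc : ℤ) : ℝ) := by
  rw [Int.cast_sub, h, h, Fin.partialSum_succ, add_sub_cancel_left]

theorem localHStarPoly_lectureHallSimplex {r : ℕ} (n : ℕ) (hr : 0 < r) :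
    localHStarPoly (lectureHallSimplex (fun _ : Fin n => r)) =
      ∑ a ∈ boxVectors (n + 1) r, (Polynomial.X : ℤ[X]) ^ ((∑ i, a i) / r) := by
  have hr' : (0 : ℝ) < r := by exact_mod_cast hr
  rw [localHStarPoly, ← finsum_mem_coe_finset]
  symm
  refine finsum_mem_eq_of_bijOn (fun a => (Fin.snoc
    (fun i : Fin n => ((Fin.partialSum a i.castSucc.succ : ℕ) : ℤ))
      (((∑ i, a i) / r : ℕ) : ℤ) :
      Fin (n + 1) → ℤ)) ⟨?_, ?_, ?_⟩ ?_
  · intro a ha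
    obtain ⟨h1, h2⟩ := mem_boxVectors.1 (Finset.mem_coe.1 ha)
    rw [Set.mem_ofPred_eq, mem_openParallelepiped_lectureHallSimplex hr]
    have hp : ∀ k, Fin.partialSum (fun k => (a k : ℝ) / r) k =
        ((Fin.partialSum a k : ℕ) : ℝ) / r := by
      intro k
      refine (congrFun (Fin.eq_partialSum (g := fun k => ((Fin.partialSum a k : ℕ) : ℝ) / r)
        (by simp) fun i => ?_) k).symm
      rw [Fin.partialSum_succ]
      push_cast
      ring
    refine ⟨fun k => a k / r, fun k => ⟨?_, ?_⟩, fun i => ?_, ?_⟩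
    · exact div_pos (by exact_mod_cast (h1 k).1) hr'
    · rw [div_lt_one hr']
      exact_mod_cast (h1 k).2
    · simp only [Fin.snoc_castSucc]
      rw [hp]
      field_simp
      simp
    · simp only [Fin.snoc_last]
      rw [hp, Fin.partialSum_last, Int.cast_natCast, Nat.cast_div h2 hr'.ne']
  · intro a ha b hb hab
    obtain ⟨-, h2⟩ := mem_boxVectors.1 (Finset.mem_coe.1 ha)
    obtain ⟨-, h3⟩ := mem_boxVectors.1 (Finset.mem_coe.1 hb)
    refine Fin.partialSum_injective (funext fun k => ?_)
    induction k using Fin.cases with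
    | zero => simp
    | succ k =>
      have h4 := congrFun hab k
      induction k using Fin.lastCases with
      | last =>
        simp only [Fin.snoc_last, Nat.cast_inj] at h4
        rw [Fin.succ_last, Fin.partialSum_last, Fin.partialSum_last, ← Nat.div_mul_cancel h2,
          h4, Nat.div_mul_cancel h3]
      | cast i => simpa only [Fin.snoc_castSucc, Nat.cast_inj] using h4
  · intro x hx
    obtain ⟨w, hw, h1, h2⟩ := (mem_openParallelepiped_lectureHallSimplex hr).1 hx
    have hp : ∀ k, r * Fin.partialSum w k = Fin.partialSum (fun k => r * w k) k := by
      intro k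
      refine (congrFun (Fin.eq_partialSum (g := fun k => (r : ℝ) * Fin.partialSum w k) (by simp)
        fun i => ?_) k)
      rw [Fin.partialSum_succ, mul_add]
    -- All partial sums of `r * w`: the initial `0`, the coordinates of `x`, and `r` times the
    -- height. They are integers, hence so are the increments `r * w k`, which form the box vector.
    set Y : Fin (n + 2) → ℤ :=
      Fin.cons 0 (Fin.snoc (fun i => x i.castSucc) (r * x (Fin.last n))) with hY
    have hYw : ∀ k, (Y k : ℝ) = Fin.partialSum (fun k => r * w k) k := by
      intro k
      rw [← hp, hY]
      induction k using Fin.cases with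
      | zero => simp
      | succ k =>
        rw [Fin.cons_succ]
        induction k using Fin.lastCases with
        | last => rw [Fin.snoc_last, Int.cast_mul, h2, Fin.succ_last, Int.cast_natCast]
        | cast i => rw [Fin.snoc_castSucc, h1]
    have hd := exists_int_of_partialSum hYw
    have hd0 : ∀ i : Fin (n + 1), 0 < Y i.succ - Y i.castSucc ∧ Y i.succ - Y i.castSucc < r := by
      intro i
      have h3 := mul_pos hr' (hw i).1
      have h4 := mul_lt_mul_of_pos_left (hw i).2 hr'
      rw [hd i] at h3 h4
      rw [mul_one] at h4
      exact ⟨by exact_mod_cast h3, by exact_mod_cast h4⟩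
    have hYa : ∀ k, ((Fin.partialSum
        (fun i : Fin (n + 1) => (Y i.succ - Y i.castSucc).toNat) k : ℕ) : ℤ) = Y k := by
      intro k
      induction k using Fin.induction with
      | zero => simp [hY]
      | succ i ih =>
        rw [Fin.partialSum_succ, Nat.cast_add, ih, Int.toNat_of_nonneg (hd0 i).1.le]
        ring
    have hsum : ((∑ i : Fin (n + 1), (Y i.succ - Y i.castSucc).toNat : ℕ) : ℤ) =
        r * x (Fin.last n) := by
      rw [← Fin.partialSum_last, hYa, hY, ← Fin.succ_last, Fin.cons_succ, Fin.snoc_last]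
    refine ⟨fun i => (Y i.succ - Y i.castSucc).toNat, ?_, ?_⟩
    · rw [Finset.mem_coe, mem_boxVectors]
      refine ⟨fun i => ?_, ?_⟩
      · have := hd0 i
        omega
      · rw [← Int.natCast_dvd_natCast, hsum]
        exact dvd_mul_right _ _
    · funext k
      induction k using Fin.lastCases with
      | last =>
        simp only [Fin.snoc_last]
        rw [Int.natCast_div, hsum, Int.mul_ediv_cancel_left _ (by exact_mod_cast hr.ne')]
      | cast i =>
        simp only [Fin.snoc_castSucc]
        rw [hYa, hY, Fin.cons_succ, Fin.snoc_castSucc]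
  · intro a ha
    simp only [Fin.snoc_last, Int.toNat_natCast]

/-! ### Counting with power series; extraction of exponents divisible by `r`. -/

namespace PowerSeries

theorem coeff_pow_card {ι R : Type*} [DecidableEq ι] [CommSemiring R] (s : Finset ι)
    (f : ℕ → R) (t : ℕ) :
    coeff t (mk f ^ s.card) = ∑ c ∈ s.finsuppAntidiag t, ∏ i ∈ s, f (c i) := by
  rw [← Finset.prod_const, coeff_prod]
  simp only [coeff_mk]

theorem coeff_mk_indicator_pow_card {ι R : Type*} [DecidableEq ι] [CommSemiring R]
    (s : Finset ι) (p : ℕ → Prop) [DecidablePred p] (t : ℕ) :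
    coeff t (mk (fun j => if p j then (1 : R) else 0) ^ s.card) =
      ((s.finsuppAntidiag t).filter fun c => ∀ i ∈ s, p (c i)).card := by
  rw [coeff_pow_card, Finset.card_filter, Nat.cast_sum]
  refine Finset.sum_congr rfl fun c _ => ?_
  rw [Finset.prod_ite_zero]
  simp

theorem X_mul_mk_one : (X * mk 1 : ℤ⟦X⟧) = mk fun j => if 0 < j then 1 else 0 := by
  ext j
  cases j <;> simp [coeff_succ_X_mul]

/-- The power series `∑ a_{rt} X^t` attached to `∑ a_j X^j`. -/
def multisection (r : ℕ) : ℤ⟦X⟧ →+ ℤ⟦X⟧ where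
  toFun f := mk fun t => coeff (r * t) f
  map_zero' := by ext; simp
  map_add' f g := by ext; simp

@[simp]
theorem coeff_multisection (r t : ℕ) (f : ℤ⟦X⟧) :
    coeff t (multisection r f) = coeff (r * t) f :=
  coeff_mk t fun t => coeff (r * t) f

theorem multisection_X_pow_mul {r : ℕ} (hr : 0 < r) (f : ℤ⟦X⟧) :
    multisection r (X ^ r * f) = X * multisection r f := by
  ext t
  rw [coeff_multisection, coeff_X_pow_mul']
  cases t with
  | zero => simp [hr.ne']
  | succ t =>
    rw [coeff_succ_X_mul, coeff_multisection, if_pos (Nat.le_mul_of_pos_right _ t.succ_pos),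
      Nat.mul_succ, Nat.add_sub_cancel]

theorem multisection_one_sub_X_pow_pow_mul {r : ℕ} (hr : 0 < r) (k : ℕ) (f : ℤ⟦X⟧) :
    multisection r ((1 - X ^ r) ^ k * f) = (1 - X) ^ k * multisection r f := by
  induction k generalizing f with
  | zero => simp
  | succ k ih =>
    rw [pow_succ, mul_assoc, ih, sub_mul, one_mul, map_sub, multisection_X_pow_mul hr]
    ring

theorem multisection_neg_one_pow_mul (r k : ℕ) (f : ℤ⟦X⟧) :
    multisection r ((-1) ^ k * f) = (-1) ^ k * multisection r f := by
  rcases neg_one_pow_eq_or ℤ⟦X⟧ k with h | h <;> simp [h]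

/-- Here `mk 1` is `1 / (1 - X)`, so the product is `1 + X + ⋯ + X^(r-1)`. -/
theorem one_sub_X_pow_mul_mk_one_sub_one {r : ℕ} (hr : 0 < r) :
    ((1 - X ^ r) * mk 1 - 1 : ℤ⟦X⟧) = mk fun j => if 0 < j ∧ j < r then 1 else 0 := by
  ext j
  rw [sub_mul, one_mul, map_sub, map_sub, coeff_X_pow_mul', coeff_one]
  simp only [coeff_mk, Pi.one_apply]
  split_ifs <;> first | rfl | omega

end PowerSeries

/-! ### The `h`-polynomial as a count of multisets supported on faces. -/

namespace PreAbstractSimplicialComplex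

variable {α : Type*}

theorem card_le_rank [Finite α] (K : PreAbstractSimplicialComplex α) {F : Finset α}
    (hF : F ∈ K.faces) : F.card ≤ K.rank :=
  le_csSup (Set.toFinite _).bddAbove ⟨F, hF, rfl⟩

open Classical in
/-- The faces of a complex, including the empty one. -/
def facesWithEmpty [Fintype α] (K : PreAbstractSimplicialComplex α) : Finset (Finset α) :=
  {S | S = ∅ ∨ S ∈ K.faces}

theorem mem_facesWithEmpty [Fintype α] {K : PreAbstractSimplicialComplex α} {S : Finset α} :
    S ∈ K.facesWithEmpty ↔ S = ∅ ∨ S ∈ K.faces := by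
  simp [facesWithEmpty]

theorem card_le_rank_of_mem_facesWithEmpty [Fintype α] {K : PreAbstractSimplicialComplex α}
    {S : Finset α} (hS : S ∈ K.facesWithEmpty) : S.card ≤ K.rank := by
  rcases mem_facesWithEmpty.1 hS with rfl | h
  · simp
  · exact K.card_le_rank h

theorem faceCount_eq_card [Fintype α] (K : PreAbstractSimplicialComplex α) (i : ℕ) :
    K.faceCount i = (K.facesWithEmpty.filter fun S => S.card = i).card := by
  rw [faceCount]
  split_ifs with h
  · subst h
    have : K.facesWithEmpty.filter (fun S => S.card = 0) = {∅} := by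
      ext S
      simp only [Finset.mem_filter, mem_facesWithEmpty, Finset.card_eq_zero,
        Finset.mem_singleton]
      tauto
    rw [this, Finset.card_singleton]
  · rw [← Set.ncard_coe_finset]
    congr 1
    ext S
    simp only [Set.mem_ofPred_eq, Finset.coe_filter, mem_facesWithEmpty]
    refine and_congr_left fun hS => (or_iff_right fun h0 => h ?_).symm
    rw [← hS, h0, Finset.card_empty]

theorem hPoly_eq_sum_facesWithEmpty [Fintype α] (K : PreAbstractSimplicialComplex α) :
    K.hPoly = ∑ S ∈ K.facesWithEmpty,
      Polynomial.X ^ S.card * (1 - Polynomial.X) ^ (K.rank - S.card) := by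
  rw [hPoly, ← Finset.sum_fiberwise_of_maps_to (t := Finset.range (K.rank + 1))
    (g := Finset.card) fun S hS =>
      Finset.mem_range.2 (Nat.lt_succ_of_le (card_le_rank_of_mem_facesWithEmpty hS))]
  refine Finset.sum_congr rfl fun i _ => ?_
  rw [faceCount_eq_card, Finset.sum_congr rfl (g := fun _ => (Polynomial.X : ℤ[X]) ^ i *
    (1 - Polynomial.X) ^ (K.rank - i)) fun S hS => by rw [(Finset.mem_filter.1 hS).2],
    Finset.sum_const, nsmul_eq_mul]

theorem coe_hPoly [Fintype α] (K : PreAbstractSimplicialComplex α) :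
    (K.hPoly : PowerSeries ℤ) = (1 - PowerSeries.X) ^ K.rank *
      ∑ S ∈ K.facesWithEmpty, (PowerSeries.X * PowerSeries.mk 1) ^ S.card := by
  rw [hPoly_eq_sum_facesWithEmpty, ← Polynomial.coeToPowerSeries.ringHom_apply, map_sum,
    Finset.mul_sum]
  refine Finset.sum_congr rfl fun S hS => ?_
  rw [map_mul, map_pow, map_pow, map_sub, map_one, Polynomial.coeToPowerSeries.ringHom_apply,
    Polynomial.coe_X]
  nth_rewrite 2 [← Nat.sub_add_cancel (card_le_rank_of_mem_facesWithEmpty hS)]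
  have h : ((1 - PowerSeries.X) * PowerSeries.mk 1 : PowerSeries ℤ) ^ S.card = 1 := by
    rw [mul_comm, PowerSeries.mk_one_mul_one_sub_eq_one, one_pow]
  rw [pow_add, mul_pow]
  rw [mul_pow] at h
  linear_combination (-PowerSeries.X ^ S.card * (1 - PowerSeries.X) ^ (K.rank - S.card) :
    PowerSeries ℤ) * h

/-- The series `(X / (1 - X))^|S|` enumerates by size the multisets whose support is exactly `S`. -/
theorem coeff_sum_facesWithEmpty [Fintype α] [DecidableEq α]
    (K : PreAbstractSimplicialComplex α) (t : ℕ) :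
    PowerSeries.coeff t (∑ S ∈ K.facesWithEmpty,
      (PowerSeries.X * PowerSeries.mk 1 : PowerSeries ℤ) ^ S.card) =
      ((Finset.univ.finsuppAntidiag t).filter fun c : α →₀ ℕ =>
        c.support ∈ K.facesWithEmpty).card := by
  have hmaps : Set.MapsTo Finsupp.support (((Finset.univ.finsuppAntidiag t).filter
      fun c : α →₀ ℕ => c.support ∈ K.facesWithEmpty : Finset (α →₀ ℕ)) : Set (α →₀ ℕ))
      (K.facesWithEmpty : Set (Finset α)) := fun c hc => (Finset.mem_filter.1 hc).2
  rw [map_sum, Finset.card_eq_sum_card_fiberwise hmaps, Nat.cast_sum]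
  refine Finset.sum_congr rfl fun S hS => ?_
  rw [PowerSeries.X_mul_mk_one, PowerSeries.coeff_mk_indicator_pow_card]
  congr 2
  ext c
  simp only [Finset.mem_filter, Finset.mem_finsuppAntidiag', Finset.subset_univ, and_true,
    pos_iff_ne_zero]
  constructor
  · rintro ⟨⟨h1, h2⟩, h3⟩
    have : c.support = S := h2.antisymm fun i hi => Finsupp.mem_support_iff.2 (h3 i hi)
    exact ⟨⟨h1, this ▸ hS⟩, this⟩
  · rintro ⟨⟨h1, -⟩, rfl⟩
    exact ⟨⟨h1, subset_rfl⟩, fun i hi => Finsupp.mem_support_iff.1 hi⟩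

end PreAbstractSimplicialComplex

/-! ### Vertices and faces of the edgewise subdivision. -/

theorem mem_smul_stdSimplex_iff {m r : ℕ} (hr : 0 < r) (x : Fin m → ℤ) :
    (fun i => (x i : ℝ)) ∈ (r : ℝ) • stdSimplex ℝ (Fin m) ↔
      (∀ i, 0 ≤ x i) ∧ ∑ i, x i = r := by
  have hr' : (0 : ℝ) < r := by exact_mod_cast hr
  rw [Set.mem_smul_set_iff_inv_smul_mem₀ hr'.ne', stdSimplex, Set.mem_ofPred_eq]
  simp only [Pi.smul_apply, smul_eq_mul, ← Finset.mul_sum]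
  refine and_congr (forall_congr' fun i => ?_) ?_
  · rw [mul_nonneg_iff_of_pos_left (inv_pos.2 hr')]
    exact Int.cast_nonneg_iff
  · rw [inv_mul_eq_one₀ hr'.ne', ← Int.cast_sum, eq_comm]
    exact_mod_cast Iff.rfl

theorem partialSums_eq {m : ℕ} (x : Fin m → ℤ) (i : Fin m) :
    partialSums x i = Fin.partialSum x i.succ :=
  Fin.sum_Iic_eq_partialSum x i

theorem partialSums_injective {m : ℕ} :
    Function.Injective (partialSums : (Fin m → ℤ) → Fin m → ℤ) := by
  intro x y h
  refine Fin.partialSum_injective (funext fun k => ?_)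
  induction k using Fin.cases with
  | zero => simp
  | succ k => rw [← partialSums_eq, ← partialSums_eq, h]

instance (m r : ℕ) : Fintype (EdgewiseVertex m r) := Fintype.ofFinite _

namespace EdgewiseVertex

variable {m r : ℕ}

theorem nonneg (hr : 0 < r) (v : EdgewiseVertex m r) (i : Fin m) : 0 ≤ v.1 i :=
  ((mem_smul_stdSimplex_iff hr v.1).1 v.2).1 i

theorem sum_eq (hr : 0 < r) (v : EdgewiseVertex m r) : ∑ i, v.1 i = r :=
  ((mem_smul_stdSimplex_iff hr v.1).1 v.2).2

/-- The coordinates of a vertex as natural numbers. -/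
def toFinsupp (v : EdgewiseVertex m r) : Fin m →₀ ℕ :=
  Finsupp.equivFunOnFinite.symm fun i => (v.1 i).toNat

@[simp]
theorem toFinsupp_apply (v : EdgewiseVertex m r) (i : Fin m) : v.toFinsupp i = (v.1 i).toNat :=
  rfl

end EdgewiseVertex

/-- A set of lattice points that is a (possibly empty) face of the edgewise subdivision. -/
def IsEdgewiseChain {m r : ℕ} (S : Finset (EdgewiseVertex m r)) : Prop :=
  ∀ x ∈ S, ∀ y ∈ S,
    (∀ i, partialSums x.1 i - partialSums y.1 i ∈ ({0, 1} : Set ℤ)) ∨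
    (∀ i, partialSums y.1 i - partialSums x.1 i ∈ ({0, 1} : Set ℤ))

section EdgewiseSubdivision

variable {m r : ℕ}

theorem IsEdgewiseChain.mono {S T : Finset (EdgewiseVertex m r)} (h : IsEdgewiseChain T)
    (hST : S ⊆ T) : IsEdgewiseChain S :=
  fun x hx y hy => h x (hST hx) y (hST hy)

theorem mem_faces_restrictTo_edgewise {F : Finset (Fin m)} {S : Finset (EdgewiseVertex m r)} :
    S ∈ ((edgewiseSubdivision m r).restrictTo (edgewiseCarrier m r) F).faces ↔
      S.Nonempty ∧ IsEdgewiseChain S ∧ edgewiseCarrier m r S ⊆ F :=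
  and_assoc

theorem edgewiseCarrier_subset_iff {F : Finset (Fin m)} {S : Finset (EdgewiseVertex m r)} :
    edgewiseCarrier m r S ⊆ F ↔ ∀ v ∈ S, ∀ i ∉ F, v.1 i = 0 := by
  change (S.biUnion fun x => latticeSupp x.1) ⊆ F ↔ _
  rw [Finset.biUnion_subset]
  refine forall₂_congr fun v _ => forall_congr' fun i => ?_
  rw [latticeSupp, Finset.mem_filter_univ]
  exact not_imp_comm

theorem mem_facesWithEmpty_restrictTo_edgewise {F : Finset (Fin m)}
    {S : Finset (EdgewiseVertex m r)} :
    S ∈ ((edgewiseSubdivision m r).restrictTo (edgewiseCarrier m r) F).facesWithEmpty ↔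
      IsEdgewiseChain S ∧ edgewiseCarrier m r S ⊆ F := by
  rw [PreAbstractSimplicialComplex.mem_facesWithEmpty, mem_faces_restrictTo_edgewise]
  rcases S.eq_empty_or_nonempty with rfl | hS
  · simp [IsEdgewiseChain, edgewiseCarrier_subset_iff]
  · simp [hS, hS.ne_empty]

/-! ### The dimension -/

/-- With `M` the maximum of `F`, a vertex supported in `F` is determined by its partial sums at
`F.erase M`: they are constant off `F`, and equal `r` at `M`. Along a chain the total `σ` of these
sums is injective and ranges over an interval of `|F|` integers. -/
theorem card_le_of_isEdgewiseChain (hr : 0 < r) {F : Finset (Fin m)}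
    {S : Finset (EdgewiseVertex m r)} (hS : IsEdgewiseChain S)
    (hF : edgewiseCarrier m r S ⊆ F) : S.card ≤ F.card := by
  rw [edgewiseCarrier_subset_iff] at hF
  rcases S.eq_empty_or_nonempty with rfl | hne
  · simp
  have hFne : F.Nonempty := by
    obtain ⟨v, hv⟩ := hne
    by_contra h
    rw [Finset.not_nonempty_iff_eq_empty] at h
    have := v.sum_eq hr
    rw [Finset.sum_eq_zero fun i _ => hF v hv i (by simp [h])] at this
    omega
  set M := F.max' hFne with hM
  have hlast : ∀ v ∈ S, partialSums v.1 M = r := by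
    intro v hv
    rw [← v.sum_eq hr, partialSums]
    refine Finset.sum_subset (Finset.subset_univ _) fun i _ hi => hF v hv i fun hiF => hi ?_
    exact Finset.mem_Iic.2 (F.le_max' i hiF)
  set σ : EdgewiseVertex m r → ℤ := fun v => ∑ i ∈ F.erase M, partialSums v.1 i with hσ
  obtain ⟨w, hw, hmin⟩ := S.exists_min_image σ hne
  have hcard : (F.erase M).card + 1 = F.card :=
    Finset.card_erase_add_one (F.max'_mem hFne)
  have hle : S.card ≤ (Finset.Icc (σ w) (σ w + (F.erase M).card)).card := by
    refine Finset.card_le_card_of_injOn σ (fun v hv => ?_) ?_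
    · refine Finset.mem_coe.2 (Finset.mem_Icc.2 ⟨hmin v hv, ?_⟩)
      rw [← sub_le_iff_le_add', hσ, ← Finset.sum_sub_distrib, Finset.card_eq_sum_ones,
        Nat.cast_sum]
      refine Finset.sum_le_sum fun i _ => ?_
      rcases hS v hv w hw with h | h <;> have := h i <;>
        simp only [Set.mem_insert_iff, Set.mem_singleton_iff] at this <;> omega
    · have key : ∀ u ∈ S, ∀ v ∈ S, σ u = σ v →
          (∀ i, partialSums u.1 i - partialSums v.1 i ∈ ({0, 1} : Set ℤ)) → u = v := by
        intro u hu v hv huv h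
        have h0 : ∀ i ∈ F.erase M, partialSums u.1 i - partialSums v.1 i = 0 := by
          refine (Finset.sum_eq_zero_iff_of_nonneg fun i _ => ?_).1 ?_
          · have := h i
            simp only [Set.mem_insert_iff, Set.mem_singleton_iff] at this
            omega
          · rw [Finset.sum_sub_distrib]
            exact sub_eq_zero.2 huv
        refine Subtype.ext (Fin.partialSum_injective (funext fun k => ?_))
        induction k using Fin.induction with
        | zero => simp
        | succ i ih =>
          by_cases hi : i ∈ F
          · rw [← partialSums_eq, ← partialSums_eq]
            by_cases hiM : i = M
            · rw [hiM, hlast u hu, hlast v hv]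
            · exact sub_eq_zero.1 (h0 i (Finset.mem_erase.2 ⟨hiM, hi⟩))
          · rw [Fin.partialSum_succ, Fin.partialSum_succ, ih, hF u hu i hi, hF v hv i hi]
      intro u hu v hv huv
      rcases hS u hu v hv with h | h
      · exact key u hu v hv huv h
      · exact (key v hv u hu huv.symm h).symm
  rw [Int.card_Icc] at hle
  omega

/-- The vertices `e_j + (r - 1) e_M`, for `j` in `F` and a fixed `M` in `F`, form such a face: up to
a common shift their partial sums are indicators of the up-sets `{i | j ≤ i}`. -/
theorem exists_isEdgewiseChain_card_eq (hr : 0 < r) {F : Finset (Fin m)} (hF : F.Nonempty) :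
    ∃ S : Finset (EdgewiseVertex m r), IsEdgewiseChain S ∧ edgewiseCarrier m r S ⊆ F ∧
      S.card = F.card := by
  classical
  obtain ⟨M, hM⟩ := hF
  have hx : ∀ j : Fin m, (fun i => (((Pi.single j 1 + Pi.single M ((r : ℤ) - 1) : Fin m → ℤ) i :
      ℤ) : ℝ)) ∈ (r : ℝ) • stdSimplex ℝ (Fin m) := by
    intro j
    rw [mem_smul_stdSimplex_iff hr]
    constructor
    · intro i
      simp only [Pi.add_apply, Pi.single_apply]
      split_ifs <;> omega
    · simp [Finset.sum_add_distrib]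
  set f : Fin m → EdgewiseVertex m r := fun j => ⟨_, hx j⟩ with hf
  have hfp : ∀ i j, partialSums (f j).1 i =
      (if j ≤ i then 1 else 0) + partialSums (Pi.single M ((r : ℤ) - 1)) i := by
    intro i j
    simp [partialSums, hf, Finset.sum_add_distrib, Pi.single_apply]
  have hinj : Function.Injective f := by
    intro j l h
    have h1 := congrFun (congrArg Subtype.val h) j
    simp only [hf, Pi.add_apply, Pi.single_eq_same, add_left_inj] at h1
    by_contra hne
    rw [Pi.single_eq_of_ne hne] at h1
    exact one_ne_zero h1
  refine ⟨F.image f, ?_, ?_, Finset.card_image_of_injective _ hinj⟩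
  · have key : ∀ j l, l ≤ j →
        ∀ i, partialSums (f l).1 i - partialSums (f j).1 i ∈ ({0, 1} : Set ℤ) := by
      intro j l hjl i
      rw [hfp, hfp, add_sub_add_right_eq_sub]
      by_cases h1 : j ≤ i
      · simp [h1, hjl.trans h1]
      · by_cases h2 : l ≤ i <;> simp [h1, h2]
    intro x hx y hy
    obtain ⟨j, -, rfl⟩ := Finset.mem_image.1 hx
    obtain ⟨l, -, rfl⟩ := Finset.mem_image.1 hy
    rcases le_total j l with h | h
    · exact Or.inl (key _ _ h)
    · exact Or.inr (key _ _ h)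
  · rw [edgewiseCarrier_subset_iff]
    intro x hx i hi
    obtain ⟨j, hj, rfl⟩ := Finset.mem_image.1 hx
    have h1 : i ≠ j := fun h => hi (h ▸ hj)
    have h2 : i ≠ M := fun h => hi (h ▸ hM)
    simp [hf, h1, h2]

theorem rank_restrictTo_edgewise (hr : 0 < r) (F : Finset (Fin m)) :
    ((edgewiseSubdivision m r).restrictTo (edgewiseCarrier m r) F).rank = F.card := by
  -- For `F = ∅` there is no nonempty face, and the supremum of the empty set is `0`.
  refine le_antisymm (csSup_le' ?_) ?_
  · rintro _ ⟨S, hS, rfl⟩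
    obtain ⟨-, h1, h2⟩ := mem_faces_restrictTo_edgewise.1 hS
    exact card_le_of_isEdgewiseChain hr h1 h2
  · rcases F.eq_empty_or_nonempty with rfl | hF
    · simp
    · obtain ⟨S, h1, h2, h3⟩ := exists_isEdgewiseChain_card_eq hr hF
      rw [← h3]
      refine PreAbstractSimplicialComplex.card_le_rank _ (mem_faces_restrictTo_edgewise.2
        ⟨Finset.card_pos.1 (h3 ▸ hF.card_pos), h1, h2⟩)

/-! ### Unimodularity: decompositions into sums of vertices of a face -/

/-- The sum of a multiset of vertices. -/
def vertexSum : (EdgewiseVertex m r →₀ ℕ) →ₗ[ℕ] (Fin m →₀ ℕ) :=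
  Finsupp.linearCombination ℕ EdgewiseVertex.toFinsupp

theorem vertexSum_apply (c : EdgewiseVertex m r →₀ ℕ) (i : Fin m) :
    vertexSum c i = ∑ v, c v * (v.1 i).toNat := by
  rw [vertexSum, Finsupp.linearCombination_apply, Finsupp.sum_fintype _ _ (by simp),
    Finsupp.finsetSum_apply]
  simp

theorem coe_vertexSum_apply (hr : 0 < r) (c : EdgewiseVertex m r →₀ ℕ) (i : Fin m) :
    (vertexSum c i : ℤ) = ∑ v, c v * v.1 i := by
  rw [vertexSum_apply, Nat.cast_sum]
  refine Finset.sum_congr rfl fun v _ => ?_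
  rw [Nat.cast_mul, Int.toNat_of_nonneg (v.nonneg hr i)]

theorem partialSums_vertexSum (hr : 0 < r) (c : EdgewiseVertex m r →₀ ℕ) (i : Fin m) :
    partialSums (fun i => (vertexSum c i : ℤ)) i = ∑ v, c v * partialSums v.1 i := by
  simp only [partialSums, coe_vertexSum_apply hr, Finset.mul_sum]
  exact Finset.sum_comm

theorem sum_vertexSum (hr : 0 < r) (c : EdgewiseVertex m r →₀ ℕ) :
    ∑ i, vertexSum c i = r * ∑ v, c v := by
  zify
  simp only [coe_vertexSum_apply hr]
  rw [Finset.sum_comm, Finset.mul_sum]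
  refine Finset.sum_congr rfl fun v _ => ?_
  rw [← Finset.mul_sum, v.sum_eq hr, mul_comm]

/-- Coordinates of vertices are nonnegative, so nothing cancels in the sum. -/
theorem edgewiseCarrier_support_subset_iff (hr : 0 < r) (c : EdgewiseVertex m r →₀ ℕ)
    (F : Finset (Fin m)) :
    edgewiseCarrier m r c.support ⊆ F ↔ (vertexSum c).support ⊆ F := by
  rw [edgewiseCarrier_subset_iff]
  simp only [Finset.subset_iff, Finsupp.mem_support_iff, vertexSum_apply, ne_eq]
  constructor
  · intro h i
    rw [not_imp_comm]
    intro hi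
    refine Finset.sum_eq_zero fun v _ => ?_
    by_cases hv : c v = 0
    · rw [hv, zero_mul]
    · rw [h v hv i hi, Int.toNat_zero, mul_zero]
  · intro h v hv i hi
    have h1 := not_imp_comm.1 (@h i) hi
    rw [Finset.sum_eq_zero_iff] at h1
    have h2 := (Nat.mul_eq_zero.1 (h1 v (Finset.mem_univ v))).resolve_left hv
    have h3 := v.nonneg hr i
    omega

theorem exists_max_of_isEdgewiseChain {S : Finset (EdgewiseVertex m r)}
    (hS : IsEdgewiseChain S) (hne : S.Nonempty) :
    ∃ w ∈ S, ∀ v ∈ S, ∀ i,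
      partialSums v.1 i ≤ partialSums w.1 i ∧ partialSums w.1 i - 1 ≤ partialSums v.1 i := by
  obtain ⟨w, hw, hmax⟩ := S.exists_max_image (fun v => ∑ i, partialSums v.1 i) hne
  refine ⟨w, hw, fun v hv i => ?_⟩
  rcases hS w hw v hv with h | h
  · have := h i
    simp only [Set.mem_insert_iff, Set.mem_singleton_iff] at this
    omega
  · have hnn : ∀ i ∈ Finset.univ, 0 ≤ partialSums v.1 i - partialSums w.1 i := by
      intro i _
      have := h i
      simp only [Set.mem_insert_iff, Set.mem_singleton_iff] at this
      omega
    have h0 := (Finset.sum_eq_zero_iff_of_nonneg hnn).1 (le_antisymm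
      (by rw [Finset.sum_sub_distrib]; exact sub_nonpos.2 (hmax v hv)) (Finset.sum_nonneg hnn)) i
      (Finset.mem_univ i)
    omega

/-- For a multiset of size `t`, this says that each partial sum of the largest vertex `w` is that of
`vertexSum c` divided by `t` and rounded up. The lower bound is strict because `w` itself occurs. -/
theorem partialSums_max_bounds (hr : 0 < r) {c : EdgewiseVertex m r →₀ ℕ}
    {w : EdgewiseVertex m r} (hw : w ∈ c.support)
    (h : ∀ v ∈ c.support, ∀ i,
      partialSums v.1 i ≤ partialSums w.1 i ∧ partialSums w.1 i - 1 ≤ partialSums v.1 i)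
    (i : Fin m) :
    ((∑ v, c v : ℕ) : ℤ) * (partialSums w.1 i - 1) <
        partialSums (fun i => (vertexSum c i : ℤ)) i ∧
      partialSums (fun i => (vertexSum c i : ℤ)) i ≤ ((∑ v, c v : ℕ) : ℤ) * partialSums w.1 i := by
  rw [partialSums_vertexSum hr, Nat.cast_sum, Finset.sum_mul, Finset.sum_mul]
  have h0 : ∀ v, c v = 0 ∨ v ∈ c.support := fun v => by
    rw [Finsupp.mem_support_iff]; exact eq_or_ne _ _
  constructor
  · refine Finset.sum_lt_sum (fun v _ => ?_) ⟨w, Finset.mem_univ w, ?_⟩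
    · rcases h0 v with hv | hv
      · simp [hv]
      · exact mul_le_mul_of_nonneg_left (h v hv i).2 (Int.natCast_nonneg _)
    · refine mul_lt_mul_of_pos_left (by omega) ?_
      have := Finsupp.mem_support_iff.1 hw
      omega
  · refine Finset.sum_le_sum fun v _ => ?_
    rcases h0 v with hv | hv
    · simp [hv]
    · exact mul_le_mul_of_nonneg_left (h v hv i).1 (Int.natCast_nonneg _)

/-- The sum determines the size `t` and, by `partialSums_max_bounds`, the largest vertex. Removing
one copy of it leaves a chain, and induction on `t` applies. -/
theorem vertexSum_injOn (hr : 0 < r) {c d : EdgewiseVertex m r →₀ ℕ}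
    (hc : IsEdgewiseChain c.support) (hd : IsEdgewiseChain d.support)
    (h : vertexSum c = vertexSum d) : c = d := by
  classical
  obtain ⟨t, ht⟩ : ∃ t, ∑ v, c v = t := ⟨_, rfl⟩
  induction t generalizing c d with
  | zero =>
    have hcd : ∑ v, d v = 0 := by
      have := sum_vertexSum hr d
      rw [← h, sum_vertexSum hr c, ht] at this
      exact (Nat.eq_of_mul_eq_mul_left hr this).symm
    ext v
    rw [Finset.sum_eq_zero_iff.1 ht v (Finset.mem_univ v),
      Finset.sum_eq_zero_iff.1 hcd v (Finset.mem_univ v)]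
  | succ t ih =>
    have hcd : ∑ v, d v = t + 1 := by
      have := sum_vertexSum hr d
      rw [← h, sum_vertexSum hr c, ht] at this
      exact (Nat.eq_of_mul_eq_mul_left hr this).symm
    have hne : ∀ e : EdgewiseVertex m r →₀ ℕ, ∑ v, e v = t + 1 → e.support.Nonempty := by
      intro e he
      rw [Finsupp.support_nonempty_iff]
      rintro rfl
      simp at he
    obtain ⟨w, hw, hwmax⟩ := exists_max_of_isEdgewiseChain hc (hne c ht)
    obtain ⟨u, hu, humax⟩ := exists_max_of_isEdgewiseChain hd (hne d hcd)
    have hwu : w = u := by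
      refine Subtype.ext (partialSums_injective (funext fun i => ?_))
      have h1 := partialSums_max_bounds hr hw hwmax i
      have h2 := partialSums_max_bounds hr hu humax i
      rw [ht] at h1
      rw [hcd, ← h] at h2
      have h3 := lt_of_mul_lt_mul_left (h1.1.trans_le h2.2) (Int.natCast_nonneg _)
      have h4 := lt_of_mul_lt_mul_left (h2.1.trans_le h1.2) (Int.natCast_nonneg _)
      omega
    subst hwu
    have hsplit : ∀ e : EdgewiseVertex m r →₀ ℕ, w ∈ e.support →
        e - Finsupp.single w 1 + Finsupp.single w 1 = e := by
      intro e he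
      refine tsub_add_cancel_of_le (Finsupp.single_le_iff.2 ?_)
      exact Nat.one_le_iff_ne_zero.2 (Finsupp.mem_support_iff.1 he)
    rw [← hsplit c hw, ← hsplit d hu]
    congr 1
    refine ih (hc.mono Finsupp.support_tsub) (hd.mono Finsupp.support_tsub) ?_ ?_
    · rw [← hsplit c hw, ← hsplit d hu, map_add, map_add] at h
      exact add_right_cancel h
    · have h1 : ∑ v, (c - Finsupp.single w 1 + Finsupp.single w 1 : EdgewiseVertex m r →₀ ℕ) v = t + 1 := by
        rw [hsplit c hw, ht]
      simp only [Finsupp.add_apply, Finset.sum_add_distrib] at h1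
      rw [show ∑ v, (Finsupp.single w 1 : EdgewiseVertex m r →₀ ℕ) v = 1 by simp [Finsupp.single_apply]] at h1
      omega

/-- Hermite's identity: raising `y` by one shifts the window of `t` consecutive terms, replacing `y
/ t` by `y / t + 1`. -/
theorem sum_range_add_div {t : ℕ} (ht : 0 < t) (y : ℕ) :
    ∑ j ∈ Finset.range t, (y + j) / t = y := by
  induction y with
  | zero =>
    exact Finset.sum_eq_zero fun j hj => by
      rw [zero_add, Nat.div_eq_of_lt (Finset.mem_range.1 hj)]
  | succ y ih =>
    have h1 := Finset.sum_range_succ (fun j => (y + j) / t) t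
    rw [Finset.sum_range_succ', ih, Nat.add_div_right _ ht, add_zero] at h1
    have h2 : ∑ j ∈ Finset.range t, (y + 1 + j) / t =
        ∑ j ∈ Finset.range t, (y + (j + 1)) / t :=
      Finset.sum_congr rfl fun j _ => by rw [add_assoc, add_comm 1 j]
    omega

theorem exists_vertexSum_eq (hr : 0 < r) (t : ℕ) (y : Fin m →₀ ℕ) (hy : ∑ i, y i = r * t) :
    ∃ c : EdgewiseVertex m r →₀ ℕ, IsEdgewiseChain c.support ∧ ∑ v, c v = t ∧
      vertexSum c = y := by
  classical
  rcases Nat.eq_zero_or_pos t with rfl | ht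
  · refine ⟨0, by simp [IsEdgewiseChain], by simp, ?_⟩
    ext i
    rw [map_zero]
    exact (Finset.sum_eq_zero_iff.1 hy i (Finset.mem_univ i)).symm
  set Y : Fin (m + 1) → ℕ := Fin.partialSum y with hY
  have hYs : ∀ i : Fin m, Y i.succ = Y i.castSucc + y i := fun i => Fin.partialSum_succ _ _
  have hmono : ∀ (j : ℕ) (i : Fin m), (Y i.castSucc + j) / t ≤ (Y i.succ + j) / t :=
    fun j i => Nat.div_le_div_right (by have := hYs i; omega)
  -- The `j`-th vertex has partial sums `⌊(Y + j) / t⌋`. These add up to `Y` over `j < t` by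
  -- Hermite's identity, and two of them differ by at most one since the shifts differ by less than
  -- `t`.
  set x : ℕ → Fin m → ℤ := fun j i => (((Y i.succ + j) / t : ℕ) : ℤ) -
    (((Y i.castSucc + j) / t : ℕ) : ℤ) with hx
  have hxp : ∀ j < t, ∀ k, Fin.partialSum (x j) k = (((Y k + j) / t : ℕ) : ℤ) := by
    intro j hj k
    refine (congrFun (Fin.eq_partialSum (g := fun k => (((Y k + j) / t : ℕ) : ℤ)) ?_
      fun i => ?_) k).symm
    · simp only [hY, Fin.partialSum_zero, zero_add, Nat.div_eq_of_lt hj, Nat.cast_zero]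
    · simp only [hx]
      ring
  have hxv : ∀ j < t, (fun i => (x j i : ℝ)) ∈ (r : ℝ) • stdSimplex ℝ (Fin m) := by
    intro j hj
    rw [mem_smul_stdSimplex_iff hr]
    refine ⟨fun i => sub_nonneg.2 (Int.ofNat_le.2 (hmono j i)), ?_⟩
    rw [← Fin.partialSum_last, hxp j hj, hY, Fin.partialSum_last, hy, mul_comm r t,
      Nat.mul_add_div ht, Nat.div_eq_of_lt hj, add_zero]
  set f : Fin t → EdgewiseVertex m r := fun j => ⟨x j, hxv j j.2⟩ with hf
  refine ⟨∑ j, Finsupp.single (f j) 1, ?_, ?_, ?_⟩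
  · have hsupp : (∑ j, Finsupp.single (f j) 1).support ⊆ Finset.univ.image f := by
      intro v hv
      rw [Finsupp.mem_support_iff, Finsupp.finsetSum_apply] at hv
      obtain ⟨j, -, hj⟩ := Finset.exists_ne_zero_of_sum_ne_zero hv
      rw [Finsupp.single_apply_ne_zero] at hj
      exact Finset.mem_image.2 ⟨j, Finset.mem_univ j, hj.1.symm⟩
    have key : ∀ j l : Fin t, l ≤ j →
        ∀ i, partialSums (f j).1 i - partialSums (f l).1 i ∈ ({0, 1} : Set ℤ) := by
      intro j l hlj i
      rw [partialSums_eq, partialSums_eq, hxp j j.2, hxp l l.2]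
      have h1 : (Y i.succ + l) / t ≤ (Y i.succ + j) / t := Nat.div_le_div_right (by omega)
      have h2 : (Y i.succ + j) / t ≤ (Y i.succ + l + t) / t := Nat.div_le_div_right (by omega)
      rw [Nat.add_div_right _ ht] at h2
      simp only [Set.mem_insert_iff, Set.mem_singleton_iff]
      omega
    refine IsEdgewiseChain.mono (T := Finset.univ.image f) (fun u hu v hv => ?_) hsupp
    obtain ⟨j, -, rfl⟩ := Finset.mem_image.1 hu
    obtain ⟨l, -, rfl⟩ := Finset.mem_image.1 hv
    rcases le_total l j with h | h
    · exact Or.inl (key _ _ h)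
    · exact Or.inr (key _ _ h)
  · simp only [Finsupp.finsetSum_apply]
    rw [Finset.sum_comm]
    simp [Finsupp.single_apply]
  · have hcoord : ∀ (j : Fin t) (i : Fin m), ((f j).toFinsupp i : ℤ) =
        (((Y i.succ + j) / t : ℕ) : ℤ) - (((Y i.castSucc + j) / t : ℕ) : ℤ) :=
      fun j i => Int.toNat_of_nonneg ((f j).nonneg hr i)
    ext i
    rw [map_sum, Finsupp.finsetSum_apply]
    simp only [vertexSum, Finsupp.linearCombination_single, one_smul]
    zify
    simp only [hcoord]
    rw [Finset.sum_sub_distrib, ← Nat.cast_sum, ← Nat.cast_sum,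
      Fin.sum_univ_eq_sum_range fun j => (Y i.succ + j) / t,
      Fin.sum_univ_eq_sum_range fun j => (Y i.castSucc + j) / t,
      sum_range_add_div ht, sum_range_add_div ht, hYs]
    push_cast
    ring

/-! ### The local `h`-polynomial of the edgewise subdivision. -/

theorem card_finsupp_facesWithEmpty_edgewise (hr : 0 < r) (F : Finset (Fin m)) (t : ℕ) :
    ((Finset.univ.finsuppAntidiag t).filter fun c : EdgewiseVertex m r →₀ ℕ =>
      c.support ∈ ((edgewiseSubdivision m r).restrictTo
        (edgewiseCarrier m r) F).facesWithEmpty).card = (F.finsuppAntidiag (r * t)).card := by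
  have hmem : ∀ (y : Fin m →₀ ℕ) s, y ∈ F.finsuppAntidiag s ↔
      ∑ i, y i = s ∧ y.support ⊆ F := by
    intro y s
    rw [Finset.mem_finsuppAntidiag']
    rw [Finsupp.sum_fintype _ _ (by simp)]
  refine Finset.card_bij (fun c _ => vertexSum c) ?_ ?_ ?_
  · intro c hc
    simp only [Finset.mem_filter, Finset.mem_finsuppAntidiag,
      mem_facesWithEmpty_restrictTo_edgewise] at hc
    rw [hmem, sum_vertexSum hr, ← edgewiseCarrier_support_subset_iff hr]
    exact ⟨by rw [hc.1.1], hc.2.2⟩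
  · intro c hc d hd h
    simp only [Finset.mem_filter, mem_facesWithEmpty_restrictTo_edgewise] at hc hd
    exact vertexSum_injOn hr hc.2.1 hd.2.1 h
  · intro y hy
    rw [hmem] at hy
    obtain ⟨c, h1, h2, h3⟩ := exists_vertexSum_eq hr t y hy.1
    refine ⟨c, ?_, h3⟩
    simp only [Finset.mem_filter, Finset.mem_finsuppAntidiag, Finset.subset_univ, and_true,
      mem_facesWithEmpty_restrictTo_edgewise]
    refine ⟨h2, h1, ?_⟩
    rw [edgewiseCarrier_support_subset_iff hr, h3]
    exact hy.2

open PowerSeries in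
theorem coe_hPoly_restrictTo_edgewise (hr : 0 < r) (F : Finset (Fin m)) :
    (((edgewiseSubdivision m r).restrictTo (edgewiseCarrier m r) F).hPoly : ℤ⟦X⟧) =
      multisection r (((1 - X ^ r) * mk 1) ^ F.card) := by
  rw [PreAbstractSimplicialComplex.coe_hPoly, rank_restrictTo_edgewise hr, mul_pow,
    multisection_one_sub_X_pow_pow_mul hr]
  congr 1
  ext t
  rw [PreAbstractSimplicialComplex.coeff_sum_facesWithEmpty,
    card_finsupp_facesWithEmpty_edgewise hr, coeff_multisection]
  -- With the trivial predicate this reads the coefficient of `X^(r t)` in `1 / (1 - X)^|F|` as the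
  -- number of lattice points.
  have := coeff_mk_indicator_pow_card (R := ℤ) F (fun _ => True) (r * t)
  simp only [if_true, implies_true, Finset.filter_true] at this
  exact this.symm

open PowerSeries in
theorem coe_edgewiseLocalHPoly (m : ℕ) (hr : 0 < r) :
    (edgewiseLocalHPoly m r : ℤ⟦X⟧) =
      multisection r ((mk fun j => if 0 < j ∧ j < r then 1 else 0) ^ m) := by
  rw [← one_sub_X_pow_mul_mk_one_sub_one hr, sub_eq_add_neg]
  -- The alternating sum over `F` is the expansion of `(A - 1)^m` with `A = (1 - X^r) / (1 - X)`;
  -- additivity of `multisection` carries it over to the `h`-polynomials.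
  have h := Finset.sum_pow_mul_eq_add_pow ((1 - X ^ r) * mk 1 : ℤ⟦X⟧) (-1)
    (Finset.univ : Finset (Fin m))
  rw [Finset.card_univ, Fintype.card_fin] at h
  rw [← h, map_sum, edgewiseLocalHPoly, PreAbstractSimplicialComplex.localHPoly,
    ← Polynomial.coeToPowerSeries.ringHom_apply, map_sum]
  refine Finset.sum_congr rfl fun F _ => ?_
  rw [map_mul, map_pow, map_neg, map_one, Polynomial.coeToPowerSeries.ringHom_apply,
    coe_hPoly_restrictTo_edgewise hr, Finset.card_univ, Fintype.card_fin, mul_comm (_ ^ F.card),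
    multisection_neg_one_pow_mul]

open PowerSeries in
theorem edgewiseLocalHPoly_eq_sum_boxVectors (m : ℕ) (hr : 0 < r) :
    edgewiseLocalHPoly m r =
      ∑ a ∈ boxVectors m r, (Polynomial.X : ℤ[X]) ^ ((∑ i, a i) / r) := by
  ext t
  rw [← Polynomial.coeff_coe, coe_edgewiseLocalHPoly m hr, coeff_multisection]
  have h := coeff_mk_indicator_pow_card (R := ℤ) (Finset.univ : Finset (Fin m))
    (fun j => 0 < j ∧ j < r) (r * t)
  rw [Finset.card_univ, Fintype.card_fin] at h
  rw [h, Polynomial.finsetSum_coeff]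
  simp only [Polynomial.coeff_X_pow]
  rw [Finset.sum_boole]
  congr 1
  refine Finset.card_nbij' (fun c => c) Finsupp.equivFunOnFinite.symm ?_ ?_ ?_ ?_
  · intro c hc
    simp only [Finset.coe_filter, Finset.mem_finsuppAntidiag, Set.mem_ofPred_eq,
      Finset.mem_univ, forall_const] at hc
    simp only [Finset.coe_filter, Set.mem_ofPred_eq, mem_boxVectors]
    rw [hc.1.1]
    exact ⟨⟨hc.2, dvd_mul_right _ _⟩, (Nat.mul_div_cancel_left t hr).symm⟩
  · intro a ha
    simp only [Finset.coe_filter, Set.mem_ofPred_eq, mem_boxVectors] at ha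
    simp only [Finset.coe_filter, Finset.mem_finsuppAntidiag, Set.mem_ofPred_eq,
      Finset.mem_univ, forall_const, Finset.subset_univ, and_true]
    refine ⟨?_, ha.1.1⟩
    rw [ha.2, Nat.mul_div_cancel' ha.1.2]
    rfl
  · intro c _
    exact Finsupp.ext fun _ => rfl
  · intro a _
    rfl

end EdgewiseSubdivision

end

theorem mainTheorem5 (n r : ℕ) (hr : 0 < r) :
    sDerangementPoly (fun _ : Fin n => r) =
        ∑ ω ∈ smirnovWords (n + 1) r, (Polynomial.X : ℤ[X]) ^ wordDes ω ∧
      edgewiseLocalHPoly (n + 1) r = localHStarPoly (lectureHallSimplex (fun _ : Fin n => r)) := by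
  rw [sDerangementPoly, localHStarPoly_lectureHallSimplex n hr,
    sum_boxVectors_eq_sum_smirnovWords (n + 1) hr]
  exact ⟨rfl, (edgewiseLocalHPoly_eq_sum_boxVectors (n + 1) hr).trans
    (sum_boxVectors_eq_sum_smirnovWords (n + 1) hr)⟩
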